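/- Let $d\ge 1$, $A\in\mathbb R^{d\times d}$, $u_0\in\mathbb R^d$, $h>0$; let $\|\cdot\|$ be the Euclidean norm and, for matrices, the induced operator norm. Let $u$ solve $u'=Au$, $u(0)=u_0$. Let $H_1,H_2,\dots$ be i.i.d. exponential random variables with mean $h$ on a probability space, $T_0=0$, $T_k=H_1+\dots+H_k$, and let $K(t)=\#\{k\ge 1: T_k\le t\}$ be the associated Poisson process with rate $1/h$. Let $(V(t),\overline V(t))_{t\ge 0}$ be the stochastic Euler dynamics: almost surely, $V(0)=\overline V(0)=u_0$; on each interval $[T_{k-1},T_k)$ one has $V'=A\overline V$ and $\overline V'=0$; and $V(T_k)=\overline V(T_k)=V(T_k-)$ for all $k\ge 1$. Then, for every fixed $h>0$, $\mathbb E\|V(\varepsilon)-u(\varepsilon)\|^2<\infty$ and $\mathbb P(K(\varepsilon)=k)>0$ for all $\varepsilon>0$ and $k\in\mathbb N_0$, and (i) $\mathbb E\big[\|V(\varepsilon)-u(\varepsilon)\|^2\mid K(\varepsilon)=k\big]^{1/2}=O(\varepsilon^2)$ as $\varepsilon\downarrow 0$, for every $k\in\mathbb N_0$; (ii) $\mathbb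 E\big[\|V(\varepsilon)-u(\varepsilon)\|^2\big]^{1/2}=O(\varepsilon^2)$ as $\varepsilon\downarrow 0$; (iii) for all $\varepsilon\in(0,1]$ and $h>0$, one has the explicit bounds $$\mathbb E\big[\|V(\varepsilon)-u_0-\varepsilon Au_0\|^2\big]\le \varepsilon^4(1+\|A\|)^2\exp\!\Big(\frac{2\varepsilon\|A\|+\varepsilon\|A\|^2}{h}\Big)\|u_0\|^2$$ (the expectation on the left being finite) and $$\mathbb E\big[\|V(\varepsilon)-u(\varepsilon)\|^2\big]^{1/2}\le \varepsilon^2\Big((1+\|A\|)\exp\!\Big(\frac{2\varepsilon\|A\|+\varepsilon\|A\|^2}{2h}\Big)+\frac{\|A\|^2}{2}e^{\varepsilon\|A\|}\Big)\|u_0\|.$$ -/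

import Mathlib

open MeasureTheory ProbabilityTheory Filter Topology Asymptotics

/-- `u` solves the autonomous initial value problem `u'(t) = f (u t)` for `t > 0`, `u 0 = u₀`. -/
structure IsODESolution {d : ℕ}
    (f : EuclideanSpace ℝ (Fin d) → EuclideanSpace ℝ (Fin d))
    (u₀ : EuclideanSpace ℝ (Fin d)) (u : ℝ → EuclideanSpace ℝ (Fin d)) : Prop where
  initial : u 0 = u₀
  continuousOn : ContinuousOn u (Set.Ici 0)
  hasDerivAt : ∀ t : ℝ, 0 < t → HasDerivAt u (f (u t)) t

/-- Jump times: `T 0 = 0` and `T n = H₁ + ⋯ + Hₙ`, where the timestep `Hₖ` is `H (k - 1)`. -/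
def jumpTime {Ω : Type*} (H : ℕ → Ω → ℝ) (n : ℕ) (ω : Ω) : ℝ :=
  ∑ i ∈ Finset.range n, H i ω

/-- The counting process of the jump times: `K t` is the number of `n ≥ 1` with `T n ≤ t`.
For i.i.d. exponential timesteps with mean `h` it is the Poisson process of rate `1 / h` that
has the same jump times as the stochastic Euler dynamics. -/
noncomputable def jumpCount {Ω : Type*} (H : ℕ → Ω → ℝ) (t : ℝ) (ω : Ω) : ℕ∞ :=
  Set.encard {n : ℕ | 1 ≤ n ∧ jumpTime H n ω ≤ t}

/-- A path `(v, w)` of the Euler dynamics of `u' = f u` with jump times `0 = T 0 < T 1 < ⋯`: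
between two jump times `v' = f w` and `w' = 0`; at each jump time `T (n + 1)` both components
take the value of the left limit of `v`; and both start in `u₀`. -/
structure IsEulerDynamicsPath {d : ℕ}
    (f : EuclideanSpace ℝ (Fin d) → EuclideanSpace ℝ (Fin d))
    (u₀ : EuclideanSpace ℝ (Fin d)) (T : ℕ → ℝ)
    (v w : ℝ → EuclideanSpace ℝ (Fin d)) : Prop where
  deriv_fst : ∀ n : ℕ, ∀ t ∈ Set.Ico (T n) (T (n + 1)),
    HasDerivWithinAt v (f (w t)) (Set.Ico (T n) (T (n + 1))) t
  deriv_snd : ∀ n : ℕ, ∀ t ∈ Set.Ico (T n) (T (n + 1)),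
    HasDerivWithinAt w 0 (Set.Ico (T n) (T (n + 1))) t
  jump_fst : ∀ n : ℕ, Tendsto v (𝓝[<] T (n + 1)) (𝓝 (v (T (n + 1))))
  jump_snd : ∀ n : ℕ, Tendsto v (𝓝[<] T (n + 1)) (𝓝 (w (T (n + 1))))
  initial_fst : v 0 = u₀
  initial_snd : w 0 = u₀

/-- `(V, Vbar)` is the stochastic Euler dynamics of `u' = f u`, `u 0 = u₀`, with stepsize
parameter `h`, driven by the i.i.d. exponential timesteps `H` with mean `h` (rate `1 / h`). -/
structure IsStochasticEulerDynamics {d : ℕ} {Ω : Type*} [MeasurableSpace Ω] (μ : Measure Ω)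
    (f : EuclideanSpace ℝ (Fin d) → EuclideanSpace ℝ (Fin d))
    (u₀ : EuclideanSpace ℝ (Fin d)) (h : ℝ) (H : ℕ → Ω → ℝ)
    (V Vbar : ℝ → Ω → EuclideanSpace ℝ (Fin d)) : Prop where
  measurable_step : ∀ n : ℕ, Measurable (H n)
  law_step : ∀ n : ℕ, μ.map (H n) = expMeasure (1 / h)
  indep_step : iIndepFun H μ
  measurable_fst : ∀ t : ℝ, 0 ≤ t → Measurable (V t)
  measurable_snd : ∀ t : ℝ, 0 ≤ t → Measurable (Vbar t)
  path : ∀ᵐ ω ∂μ, IsEulerDynamicsPath f u₀ (fun n => jumpTime H n ω)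
    (fun t => V t ω) (fun t => Vbar t ω)

/-! If `ε` lies between the `n`-th and the `(n+1)`-st jump time, `V ε` is the outcome of `n + 1`
explicit Euler steps from `u₀` whose random lengths add up to `ε`; the last step is the unfinished
one. With `L` the operator of `A`, `c = 1 + ‖L‖` and `ε ≤ 1`, each step costs at most a factor `c`,
and `EulerStepBound.step` propagates the pathwise bound `‖V ε - (u₀ + ε • L u₀)‖ ≤ ε ^ 2 * c ^ (n +
1) * ‖u₀‖`. However the jumps fall, the path thus agrees with the exact flow to first order.

For fixed `n` this, with the deterministic Taylor remainder of `u`, gives (i). For the unconditional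
bounds, the square `c ^ 2 * (c ^ 2) ^ n` is averaged over the Poisson law of the number of jumps
(`measure_mem_Ico_jumpTime`, `tsum_ofReal_mul_poisson`); its generating function at `c ^ 2` is `exp
((c ^ 2 - 1) * ε / h)`, the exponential in (iii). Minkowski's inequality then replaces the Taylor
polynomial by `u ε`, and (ii) follows. -/

/-! ### Error propagation for explicit Euler steps of variable length. -/

section Deterministic

variable {E : Type*} [NormedAddCommGroup E] [NormedSpace ℝ E]

/-- A function on `[a, b)` with constant derivative is affine. -/
lemma eq_add_smul_of_hasDerivWithinAt_const {g : ℝ → E} {a b t : ℝ} {y : E}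
    (hg : ∀ s ∈ Set.Ico a b, HasDerivWithinAt g y (Set.Ico a b) s) (ht : t ∈ Set.Ico a b) :
    g t = g a + (t - a) • y := by
  have hd : ∀ s ∈ Set.Ico a b,
      HasDerivWithinAt (fun s => g s - s • y) 0 (Set.Ico a b) s := fun s hs => by
    simpa using! (hg s hs).sub (((hasDerivAt_id s).smul_const y).hasDerivWithinAt)
  have ha : a ∈ Set.Ico a b := ⟨le_rfl, ht.1.trans_lt ht.2⟩
  have := (convex_Ico a b).norm_image_sub_le_of_norm_hasDerivWithin_le (C := 0) hd
    (fun _ _ => by simp) ha ht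
  rw [zero_mul, norm_le_zero_iff, sub_eq_zero, sub_eq_iff_eq_add] at this
  rw [this]
  module

/-- The bounds propagated by explicit Euler steps of `u' = L u`: after `n` steps up to time `s`,
the state `x` and its first two Taylor remainders are bounded in terms of `c ^ n`. -/
structure EulerStepBound (L : E →L[ℝ] E) (u₀ : E) (c : ℝ) (n : ℕ) (s : ℝ) (x : E) : Prop where
  norm_le : ‖x‖ ≤ c ^ n * ‖u₀‖
  norm_sub_le : ‖x - u₀‖ ≤ s * (c ^ n - 1) * ‖u₀‖
  norm_taylor_le : ‖x - (u₀ + s • L u₀)‖ ≤ s ^ 2 * c ^ n * ‖u₀‖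

lemma EulerStepBound.zero (L : E →L[ℝ] E) (u₀ : E) (c : ℝ) :
    EulerStepBound L u₀ c 0 0 u₀ := ⟨by simp, by simp, by simp⟩

/-- The Taylor remainder grows by exactly `δ • L (x - u₀)`, which the second bound makes of order `δ
* s`. The second bound closes by telescoping, since `‖L‖ ≤ c - 1` turns each increment into `c ^ (n
+ 1) - c ^ n`. The hypothesis `hc'` controls the growth of the norm and matters when `δ > 1`. -/
lemma EulerStepBound.step {L : E →L[ℝ] E} {u₀ : E} {c : ℝ} {n : ℕ} {s : ℝ} {x : E}
    (hx : EulerStepBound L u₀ c n s x) (hs : 0 ≤ s) {δ : ℝ} (hδ : 0 ≤ δ)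
    (hc : 1 + ‖L‖ ≤ c) (hc' : 1 + δ * ‖L‖ ≤ c) :
    EulerStepBound L u₀ c (n + 1) (s + δ) (x + δ • L x) := by
  have hL := norm_nonneg L
  have h1 : 1 ≤ c := by linarith
  have hcn : 1 ≤ c ^ n := one_le_pow₀ h1
  have hcn1 : c ^ n ≤ c ^ (n + 1) := pow_le_pow_right₀ h1 n.le_succ
  have hstep : ‖δ • L x‖ ≤ δ * ‖L‖ * (c ^ n * ‖u₀‖) := by
    rw [norm_smul, Real.norm_of_nonneg hδ, mul_assoc]
    gcongr
    exact (L.le_opNorm x).trans (by gcongr; exact hx.norm_le)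
  refine ⟨?_, ?_, ?_⟩
  · calc ‖x + δ • L x‖ ≤ c ^ n * ‖u₀‖ + δ * ‖L‖ * (c ^ n * ‖u₀‖) :=
          (norm_add_le _ _).trans (add_le_add hx.norm_le hstep)
      _ = (1 + δ * ‖L‖) * (c ^ n * ‖u₀‖) := by ring
      _ ≤ c * (c ^ n * ‖u₀‖) := by gcongr
      _ = c ^ (n + 1) * ‖u₀‖ := by ring
  · calc ‖x + δ • L x - u₀‖ = ‖(x - u₀) + δ • L x‖ := by congr 1; abel
      _ ≤ s * (c ^ n - 1) * ‖u₀‖ + δ * ‖L‖ * (c ^ n * ‖u₀‖) :=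
          (norm_add_le _ _).trans (add_le_add hx.norm_sub_le hstep)
      _ ≤ s * (c ^ (n + 1) - 1) * ‖u₀‖ + δ * (c - 1) * (c ^ n * ‖u₀‖) := by
          gcongr; linarith
      _ = s * (c ^ (n + 1) - 1) * ‖u₀‖ + δ * (c ^ (n + 1) - c ^ n) * ‖u₀‖ := by ring
      _ ≤ s * (c ^ (n + 1) - 1) * ‖u₀‖ + δ * (c ^ (n + 1) - 1) * ‖u₀‖ := by gcongr
      _ = (s + δ) * (c ^ (n + 1) - 1) * ‖u₀‖ := by ring
  · have hstep' : ‖δ • L (x - u₀)‖ ≤ δ * ‖L‖ * (s * c ^ n * ‖u₀‖) := by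
      rw [norm_smul, Real.norm_of_nonneg hδ, mul_assoc]
      gcongr
      refine (L.le_opNorm _).trans ?_
      gcongr
      refine hx.norm_sub_le.trans ?_
      gcongr
      linarith
    calc ‖x + δ • L x - (u₀ + (s + δ) • L u₀)‖
        = ‖(x - (u₀ + s • L u₀)) + δ • L (x - u₀)‖ := by
          congr 1; rw [map_sub]; module
      _ ≤ s ^ 2 * c ^ n * ‖u₀‖ + δ * ‖L‖ * (s * c ^ n * ‖u₀‖) :=
          (norm_add_le _ _).trans (add_le_add hx.norm_taylor_le hstep')
      _ ≤ s ^ 2 * c ^ n * ‖u₀‖ + δ * (c - 1) * (s * c ^ n * ‖u₀‖) := by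
          gcongr; linarith
      _ = s ^ 2 * c ^ n * ‖u₀‖ + δ * s * (c ^ (n + 1) - c ^ n) * ‖u₀‖ := by ring
      -- Dropping `c ^ n` is affordable because `s ^ 2 + δ * s ≤ (s + δ) ^ 2`.
      _ ≤ s ^ 2 * c ^ (n + 1) * ‖u₀‖ + δ * s * (c ^ (n + 1) - 0) * ‖u₀‖ := by
          gcongr; linarith
      _ = (s ^ 2 + δ * s) * c ^ (n + 1) * ‖u₀‖ := by ring
      _ ≤ (s + δ) ^ 2 * c ^ (n + 1) * ‖u₀‖ := by
          gcongr
          nlinarith [mul_nonneg hs hδ, sq_nonneg δ]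

end Deterministic

/-! ### Taylor remainders of the exact solution. -/

section ODE

variable {d : ℕ} {L : EuclideanSpace ℝ (Fin d) →L[ℝ] EuclideanSpace ℝ (Fin d)}
  {u₀ : EuclideanSpace ℝ (Fin d)}

/-- The equation is only assumed for positive times; at `0` the right derivative is recovered as the
limit of the derivatives, by continuity of `u` and `L`. -/
lemma IsODESolution.hasDerivWithinAt_Ici {u : ℝ → EuclideanSpace ℝ (Fin d)}
    (hu : IsODESolution (fun x => L x) u₀ u) {t : ℝ} (ht : 0 ≤ t) :
    HasDerivWithinAt u (L (u t)) (Set.Ici t) t := by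
  rcases ht.eq_or_lt with rfl | ht
  · have h0 : ContinuousWithinAt u (Set.Ioi 0) 0 :=
      (hu.continuousOn 0 Set.self_mem_Ici).mono Set.Ioi_subset_Ici_self
    refine hasDerivWithinAt_Ici_of_tendsto_deriv (s := Set.Ioi 0)
      (fun s hs => (hu.hasDerivAt s hs).differentiableAt.differentiableWithinAt) h0
      self_mem_nhdsWithin ?_
    refine Tendsto.congr' ?_ ((L.continuous.tendsto _).comp h0)
    filter_upwards [self_mem_nhdsWithin] with s hs
    exact (hu.hasDerivAt s hs).deriv.symm
  · exact (hu.hasDerivAt t ht).hasDerivWithinAt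

lemma IsODESolution.norm_le {u : ℝ → EuclideanSpace ℝ (Fin d)}
    (hu : IsODESolution (fun x => L x) u₀ u) {t : ℝ} (ht : 0 ≤ t) :
    ‖u t‖ ≤ ‖u₀‖ * Real.exp (‖L‖ * t) := by
  have := norm_le_gronwallBound_of_norm_deriv_right_le (f := u) (f' := fun s => L (u s))
    (δ := ‖u₀‖) (K := ‖L‖) (ε := 0) (a := 0) (b := t)
    (hu.continuousOn.mono Set.Icc_subset_Ici_self)
    (fun s hs => hu.hasDerivWithinAt_Ici hs.1) (by rw [hu.initial])
    (fun s _ => by simpa using L.le_opNorm (u s)) t ⟨ht, le_rfl⟩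
  simpa [gronwallBound_ε0] using this

/-- The comparison function vanishes at `0`, and the first product-rule term of its derivative
already dominates `‖L (u s)‖` by the Gronwall bound; the other term is nonnegative. The next lemma
repeats this one order higher, with `L (u s - u₀)` as the derivative. -/
lemma IsODESolution.norm_sub_le {u : ℝ → EuclideanSpace ℝ (Fin d)}
    (hu : IsODESolution (fun x => L x) u₀ u) {t : ℝ} (ht : 0 ≤ t) :
    ‖u t - u₀‖ ≤ ‖L‖ * t * Real.exp (‖L‖ * t) * ‖u₀‖ := by
  have hL := norm_nonneg L
  refine image_norm_le_of_norm_deriv_right_le_deriv_boundary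
    (f := fun s => u s - u₀) (f' := fun s => L (u s)) (a := 0) (b := t)
    (B := fun s => ‖L‖ * s * Real.exp (‖L‖ * s) * ‖u₀‖)
    (B' := fun s => (‖L‖ * Real.exp (‖L‖ * s) +
      ‖L‖ * s * (Real.exp (‖L‖ * s) * ‖L‖)) * ‖u₀‖)
    ((hu.continuousOn.mono Set.Icc_subset_Ici_self).sub continuousOn_const)
    (fun s hs => (hu.hasDerivWithinAt_Ici hs.1).sub_const _) (by simp [hu.initial])
    (fun s => ?_) (fun s hs => ?_) ⟨ht, le_rfl⟩
  · have h1 : HasDerivAt (fun s => ‖L‖ * s) ‖L‖ s := by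
      simpa using (hasDerivAt_id s).const_mul ‖L‖
    exact (h1.mul h1.exp).mul_const _
  · have hs0 := hs.1
    calc ‖L (u s)‖ ≤ ‖L‖ * (‖u₀‖ * Real.exp (‖L‖ * s)) :=
          (L.le_opNorm _).trans (by gcongr; exact hu.norm_le hs0)
      _ = (‖L‖ * Real.exp (‖L‖ * s) + 0) * ‖u₀‖ := by ring
      _ ≤ _ := by gcongr; positivity

lemma IsODESolution.norm_taylor_le {u : ℝ → EuclideanSpace ℝ (Fin d)}
    (hu : IsODESolution (fun x => L x) u₀ u) {t : ℝ} (ht : 0 ≤ t) :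
    ‖u t - (u₀ + t • L u₀)‖ ≤ t ^ 2 * (‖L‖ ^ 2 / 2 * Real.exp (t * ‖L‖)) * ‖u₀‖ := by
  have hL := norm_nonneg L
  refine image_norm_le_of_norm_deriv_right_le_deriv_boundary
    (f := fun s => u s - (u₀ + s • L u₀)) (f' := fun s => L (u s) - L u₀) (a := 0) (b := t)
    (B := fun s => s ^ 2 * (‖L‖ ^ 2 / 2 * Real.exp (s * ‖L‖)) * ‖u₀‖)
    (B' := fun s => (2 * s * (‖L‖ ^ 2 / 2 * Real.exp (s * ‖L‖)) +
      s ^ 2 * (‖L‖ ^ 2 / 2 * (Real.exp (s * ‖L‖) * ‖L‖))) * ‖u₀‖)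
    ((hu.continuousOn.mono Set.Icc_subset_Ici_self).sub (by fun_prop))
    (fun s hs => ?_) (by simp [hu.initial])
    (fun s => ?_) (fun s hs => ?_) ⟨ht, le_rfl⟩
  · refine (hu.hasDerivWithinAt_Ici hs.1).sub ?_
    simpa using (((hasDerivAt_id s).smul_const (L u₀)).const_add u₀).hasDerivWithinAt
  · have h1 : HasDerivAt (fun s => s * ‖L‖) ‖L‖ s := by
      simpa using (hasDerivAt_id s).mul_const ‖L‖
    have h2 : HasDerivAt (fun s : ℝ => s ^ 2) (2 * s) s := by
      simpa using hasDerivAt_pow 2 s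
    exact (h2.mul (h1.exp.const_mul _)).mul_const _
  · have hs0 := hs.1
    calc ‖L (u s) - L u₀‖ = ‖L (u s - u₀)‖ := by rw [map_sub]
      _ ≤ ‖L‖ * (‖L‖ * s * Real.exp (‖L‖ * s) * ‖u₀‖) :=
          (L.le_opNorm _).trans (by gcongr; exact hu.norm_sub_le hs0)
      _ = (2 * s * (‖L‖ ^ 2 / 2 * Real.exp (s * ‖L‖)) + 0) * ‖u₀‖ := by
          rw [mul_comm s ‖L‖]; ring
      _ ≤ _ := by gcongr; positivity

end ODE

/-! ### Euler dynamics paths as Euler schemes. -/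

section EulerPath

variable {d : ℕ} {L : EuclideanSpace ℝ (Fin d) →L[ℝ] EuclideanSpace ℝ (Fin d)}
  {u₀ : EuclideanSpace ℝ (Fin d)} {T : ℕ → ℝ} {v w : ℝ → EuclideanSpace ℝ (Fin d)}

lemma IsEulerDynamicsPath.eq_of_mem_Ico
    (hp : IsEulerDynamicsPath (fun x => L x) u₀ T v w) {n : ℕ} {t : ℝ}
    (ht : t ∈ Set.Ico (T n) (T (n + 1))) : v t = v (T n) + (t - T n) • L (w (T n)) := by
  refine eq_add_smul_of_hasDerivWithinAt_const (fun s hs => ?_) ht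
  have hw : w s = w (T n) := by
    simpa using eq_add_smul_of_hasDerivWithinAt_const (hp.deriv_snd n) hs
  simpa [hw] using hp.deriv_fst n s hs

lemma IsEulerDynamicsPath.fst_eq_snd (hp : IsEulerDynamicsPath (fun x => L x) u₀ T v w)
    (h0 : T 0 = 0) (n : ℕ) : v (T n) = w (T n) := by
  cases n with
  | zero => rw [h0, hp.initial_fst, hp.initial_snd]
  | succ n => exact tendsto_nhds_unique (hp.jump_fst n) (hp.jump_snd n)

lemma IsEulerDynamicsPath.fst_succ (hp : IsEulerDynamicsPath (fun x => L x) u₀ T v w)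
    (h0 : T 0 = 0) (hT : StrictMono T) (n : ℕ) :
    v (T (n + 1)) = v (T n) + (T (n + 1) - T n) • L (v (T n)) := by
  refine tendsto_nhds_unique (hp.jump_fst n) ?_
  have hc : Tendsto (fun t => v (T n) + (t - T n) • L (v (T n))) (𝓝[<] T (n + 1))
      (𝓝 (v (T n) + (T (n + 1) - T n) • L (v (T n)))) :=
    (Continuous.tendsto (by fun_prop) _).mono_left nhdsWithin_le_nhds
  refine hc.congr' ?_
  filter_upwards [Ico_mem_nhdsLT (hT n.lt_succ_self)] with t ht
  rw [hp.eq_of_mem_Ico ht, ← hp.fst_eq_snd h0]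

lemma IsEulerDynamicsPath.eulerStepBound (hp : IsEulerDynamicsPath (fun x => L x) u₀ T v w)
    (h0 : T 0 = 0) (hT : StrictMono T) {c : ℝ} (hc : 1 + ‖L‖ ≤ c) {t : ℝ}
    (hc' : 1 + t * ‖L‖ ≤ c) (n : ℕ) (hn : T n ≤ t) :
    EulerStepBound L u₀ c n (T n) (v (T n)) := by
  have hL := norm_nonneg L
  induction n with
  | zero => rw [h0, hp.initial_fst]; exact .zero L u₀ c
  | succ n ih =>
    have hlt := hT n.lt_succ_self
    have hn0 : 0 ≤ T n := h0 ▸ hT.monotone n.zero_le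
    have := (ih (hlt.le.trans hn)).step hn0 (sub_nonneg.2 hlt.le) hc
      (le_trans (by gcongr; linarith) hc')
    rwa [add_sub_cancel, ← hp.fst_succ h0 hT] at this

/-- The unfinished step from `T n` to `t` counts as one more Euler step, hence the exponent `n + 1`.
-/
lemma IsEulerDynamicsPath.norm_taylor_le (hp : IsEulerDynamicsPath (fun x => L x) u₀ T v w)
    (h0 : T 0 = 0) (hT : StrictMono T) {c : ℝ} (hc : 1 + ‖L‖ ≤ c) {t : ℝ}
    (hc' : 1 + t * ‖L‖ ≤ c) {n : ℕ} (ht : t ∈ Set.Ico (T n) (T (n + 1))) :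
    ‖v t - (u₀ + t • L u₀)‖ ≤ t ^ 2 * c ^ (n + 1) * ‖u₀‖ := by
  have hL := norm_nonneg L
  have hn0 : 0 ≤ T n := h0 ▸ hT.monotone n.zero_le
  have := (hp.eulerStepBound h0 hT hc hc' n ht.1).step hn0 (sub_nonneg.2 ht.1) hc
    (le_trans (by gcongr; linarith) hc')
  have := this.norm_taylor_le
  rwa [add_sub_cancel, show v (T n) + (t - T n) • L (v (T n)) = v t by
    rw [hp.eq_of_mem_Ico ht, hp.fst_eq_snd h0]] at this

end EulerPath

/-! ### Integrals against the exponential law. -/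

section Exponential

lemma lintegral_expMeasure (r : ℝ) {f : ℝ → ENNReal} (hf : Measurable f) :
    ∫⁻ x, f x ∂(expMeasure r) =
      ∫⁻ x in Set.Ici 0, ENNReal.ofReal (r * Real.exp (-(r * x))) * f x := by
  have hpdf : gammaPDF 1 r = exponentialPDF r := rfl
  have hm : Measurable (exponentialPDF r) := (measurable_exponentialPDFReal r).ennreal_ofReal
  rw [expMeasure, gammaMeasure, hpdf, lintegral_withDensity_eq_lintegral_mul _ hm hf,
    ← lintegral_indicator measurableSet_Ici]
  congr 1 with x
  by_cases hx : 0 ≤ x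
  · simp [hx, exponentialPDF_of_nonneg hx]
  · simp [hx, exponentialPDF_of_neg (not_le.1 hx)]

lemma expMeasure_Ioi {r : ℝ} (hr : 0 < r) {x : ℝ} (hx : 0 ≤ x) :
    expMeasure r (Set.Ioi x) = ENNReal.ofReal (Real.exp (-(r * x))) := by
  have := isProbabilityMeasure_expMeasure hr
  have h1 : Real.exp (-(r * x)) ≤ 1 := Real.exp_le_one_iff.2 (by nlinarith)
  rw [← Set.compl_Iic, prob_compl_eq_one_sub measurableSet_Iic, ← ofReal_cdf,
    cdf_expMeasure_eq hr, if_pos hx, ← ENNReal.ofReal_one,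
    ← ENNReal.ofReal_sub _ (by linarith)]
  simp

lemma expMeasure_Iic_zero {r : ℝ} (hr : 0 < r) : expMeasure r (Set.Iic 0) = 0 := by
  have := isProbabilityMeasure_expMeasure hr
  rw [← ofReal_cdf, cdf_expMeasure_eq hr]
  simp

/-- Integration of the Poisson weights against Lebesgue measure. -/
lemma lintegral_Icc_pow_div_factorial {r t : ℝ} (hr : 0 < r) (ht : 0 ≤ t) (n : ℕ) :
    ∫⁻ s in Set.Icc 0 t, ENNReal.ofReal (r * ((r * (t - s)) ^ n / n.factorial)) =
      ENNReal.ofReal ((r * t) ^ (n + 1) / (n + 1).factorial) := by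
  have hc : Continuous fun s : ℝ => r * ((r * (t - s)) ^ n / n.factorial) := by fun_prop
  rw [← ofReal_integral_eq_lintegral_ofReal hc.continuousOn.integrableOn_Icc,
    integral_Icc_eq_integral_Ioc, ← intervalIntegral.integral_of_le ht,
    intervalIntegral.integral_eq_sub_of_hasDerivAt
      (f := fun s => -((r * (t - s)) ^ (n + 1) / (n + 1).factorial))
      (fun s _ => ?_) (hc.intervalIntegrable _ _)]
  · simp
  · have h1 : HasDerivAt (fun s => r * (t - s)) (r * -1) s :=
      ((hasDerivAt_id s).const_sub t).const_mul r
    convert! ((h1.pow (n + 1)).div_const ((n + 1).factorial : ℝ)).neg using 1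
    rw [Nat.factorial_succ]
    have : (n.factorial : ℝ) ≠ 0 := by positivity
    push_cast
    field_simp
  · rw [EventuallyLE, ae_restrict_iff' measurableSet_Icc]
    refine ae_of_all _ fun s hs => ?_
    have : 0 ≤ t - s := sub_nonneg.2 hs.2
    simp only [Pi.zero_apply]
    positivity

end Exponential

/-! ### Poisson law of the jump count. -/

section JumpTimes

variable {Ω : Type*} {H : ℕ → Ω → ℝ}

lemma jumpTime_zero (ω : Ω) : jumpTime H 0 ω = 0 := by simp [jumpTime]

lemma jumpTime_succ (n : ℕ) (ω : Ω) : jumpTime H (n + 1) ω = jumpTime H n ω + H n ω := by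
  simp [jumpTime, Finset.sum_range_succ]

lemma strictMono_jumpTime {ω : Ω} (h : ∀ n, 0 < H n ω) : StrictMono fun n => jumpTime H n ω :=
  strictMono_nat_of_lt_succ fun n => by rw [jumpTime_succ]; linarith [h n]

lemma jumpCount_eq_of_mem_Ico {ω : Ω} (hT : StrictMono fun n => jumpTime H n ω) {n : ℕ} {t : ℝ}
    (ht : t ∈ Set.Ico (jumpTime H n ω) (jumpTime H (n + 1) ω)) : jumpCount H t ω = n := by
  have : {m : ℕ | 1 ≤ m ∧ jumpTime H m ω ≤ t} = (Finset.Icc 1 n : Finset ℕ) := by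
    ext m
    simp only [Set.mem_ofPred_eq, Finset.coe_Icc, Set.mem_Icc, and_congr_right_iff]
    refine fun _ => ⟨fun h => ?_, fun h => (hT.monotone h).trans ht.1⟩
    exact Nat.lt_succ_iff.1 (hT.lt_iff_lt.1 (h.trans_lt ht.2))
  rw [jumpCount, this, Set.encard_coe_eq_coe_finsetCard]
  simp

variable [MeasurableSpace Ω] {μ : Measure Ω}

lemma measurable_jumpTime (hm : ∀ n, Measurable (H n)) (n : ℕ) : Measurable (jumpTime H n) := by
  unfold jumpTime
  fun_prop

lemma measurableSet_mem_Ico_jumpTime (hm : ∀ n, Measurable (H n)) (n : ℕ) (t : ℝ) :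
    MeasurableSet {ω | t ∈ Set.Ico (jumpTime H n ω) (jumpTime H (n + 1) ω)} :=
  (measurableSet_le (measurable_jumpTime hm n) measurable_const).inter
    (measurableSet_lt measurable_const (measurable_jumpTime hm (n + 1)))

lemma indepFun_jumpTime (hm : ∀ n, Measurable (H n)) (hi : iIndepFun H μ) (n : ℕ) :
    IndepFun (jumpTime H n) (H n) μ := by
  have := hi.indepFun_sum_range_succ hm n
  convert! this using 1
  ext ω
  simp [jumpTime]

variable {r : ℝ}

lemma ae_strictMono_jumpTime (hr : 0 < r) (hm : ∀ n, Measurable (H n))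
    (hl : ∀ n, μ.map (H n) = expMeasure r) :
    ∀ᵐ ω ∂μ, StrictMono fun n => jumpTime H n ω := by
  have : ∀ᵐ ω ∂μ, ∀ n, 0 < H n ω := ae_all_iff.2 fun n => by
    have h0 := expMeasure_Iic_zero hr
    rw [← hl n, Measure.map_apply (hm n) measurableSet_Iic] at h0
    filter_upwards [measure_eq_zero_iff_ae_notMem.1 h0] with ω hω
    simpa using hω
  filter_upwards [this] with ω hω using strictMono_jumpTime hω

variable [IsProbabilityMeasure μ]

lemma lintegral_jumpTime_step (hm : ∀ n, Measurable (H n))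
    (hl : ∀ n, μ.map (H n) = expMeasure r) (hi : iIndepFun H μ) (n : ℕ)
    {f : ℝ × ℝ → ENNReal} (hf : Measurable f) :
    ∫⁻ ω, f (jumpTime H n ω, H n ω) ∂μ =
      ∫⁻ s, ∫⁻ ω, f (jumpTime H n ω, s) ∂μ ∂(expMeasure r) := by
  have hT := measurable_jumpTime hm n
  have := Measure.isProbabilityMeasure_map (μ := μ) hT.aemeasurable
  have := Measure.isProbabilityMeasure_map (μ := μ) (hm n).aemeasurable
  rw [← lintegral_map hf (hT.prodMk (hm n)),
    (indepFun_jumpTime hm hi n).map_prod_eq_prod_map_map hT.aemeasurable (hm n).aemeasurable,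
    lintegral_prod_symm _ hf.aemeasurable, hl n]
  congr 1 with s
  rw [lintegral_map (f := fun x => f (x, s)) (hf.comp (by fun_prop)) hT]

/-- The weight `exp (r * x)` cancels the exponential density of each increment, so an induction step
is just integration of the previous polynomial over `[0, t]`. This truncated moment is what
conditioning on `jumpTime H n` produces in the Poisson law. -/
lemma lintegral_exp_jumpTime (hr : 0 < r) (hm : ∀ n, Measurable (H n))
    (hl : ∀ n, μ.map (H n) = expMeasure r) (hi : iIndepFun H μ) (n : ℕ) (t : ℝ) :
    ∫⁻ ω, (Set.Iic t).indicator (fun x => ENNReal.ofReal (Real.exp (r * x))) (jumpTime H n ω) ∂μ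
      = (Set.Ici 0).indicator (fun t => ENNReal.ofReal ((r * t) ^ n / n.factorial)) t := by
  have hg : ∀ t, Measurable
      ((Set.Iic t).indicator (fun x : ℝ => ENNReal.ofReal (Real.exp (r * x)))) :=
    fun t => Measurable.indicator (by fun_prop) measurableSet_Iic
  induction n generalizing t with
  | zero => simp [jumpTime_zero, Set.indicator_apply]
  | succ n ih =>
    have hshift : ∀ x s : ℝ, (Set.Iic t).indicator
        (fun x => ENNReal.ofReal (Real.exp (r * x))) (x + s) = ENNReal.ofReal (Real.exp (r * s)) *
          (Set.Iic (t - s)).indicator (fun x => ENNReal.ofReal (Real.exp (r * x))) x := by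
      intro x s
      simp only [Set.indicator_apply, Set.mem_Iic, le_sub_iff_add_le]
      split_ifs
      · rw [← ENNReal.ofReal_mul (Real.exp_nonneg _), ← Real.exp_add]
        ring_nf
      · simp
    have hT := measurable_jumpTime hm n
    simp only [jumpTime_succ]
    rw [lintegral_jumpTime_step hm hl hi n
      (f := fun p => (Set.Iic t).indicator
        (fun x => ENNReal.ofReal (Real.exp (r * x))) (p.1 + p.2)) ((hg t).comp (by fun_prop))]
    have hinner : ∀ s, ∫⁻ ω, (Set.Iic t).indicator
        (fun x => ENNReal.ofReal (Real.exp (r * x))) (jumpTime H n ω + s) ∂μ =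
        ENNReal.ofReal (Real.exp (r * s)) * (Set.Ici 0).indicator
          (fun t => ENNReal.ofReal ((r * t) ^ n / n.factorial)) (t - s) := fun s => by
      simp only [hshift]
      rw [lintegral_const_mul _ (by exact (hg _).comp hT), ih]
    simp only [hinner]
    rw [lintegral_expMeasure]
    · have hcongr : ∀ s, ENNReal.ofReal (r * Real.exp (-(r * s))) *
          (ENNReal.ofReal (Real.exp (r * s)) * (Set.Ici 0).indicator
            (fun t => ENNReal.ofReal ((r * t) ^ n / n.factorial)) (t - s)) =
          (Set.Iic t).indicator
            (fun s => ENNReal.ofReal (r * ((r * (t - s)) ^ n / n.factorial))) s := by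
        intro s
        rw [← mul_assoc, ← ENNReal.ofReal_mul (by positivity), mul_assoc r, ← Real.exp_add,
          neg_add_cancel, Real.exp_zero, mul_one]
        simp only [Set.indicator_apply, Set.mem_Ici, Set.mem_Iic, sub_nonneg]
        split_ifs
        · rw [ENNReal.ofReal_mul hr.le]
        · simp
      simp only [hcongr]
      rw [setLIntegral_indicator measurableSet_Iic, Set.inter_comm, Set.Ici_inter_Iic]
      by_cases ht : 0 ≤ t
      · rw [lintegral_Icc_pow_div_factorial hr ht, Set.indicator_of_mem (by simpa using ht)]
      · rw [Set.Icc_eq_empty ht, Set.indicator_of_notMem (by simpa using ht)]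
        simp
    · refine Measurable.mul (by fun_prop) ?_
      exact (Measurable.indicator (by fun_prop) measurableSet_Ici).comp (by fun_prop)

/-- The Poisson law of the number of jumps up to time `t`. -/
lemma measure_mem_Ico_jumpTime (hr : 0 < r) (hm : ∀ n, Measurable (H n))
    (hl : ∀ n, μ.map (H n) = expMeasure r) (hi : iIndepFun H μ) (n : ℕ) {t : ℝ} (ht : 0 ≤ t) :
    μ {ω | t ∈ Set.Ico (jumpTime H n ω) (jumpTime H (n + 1) ω)} =
      ENNReal.ofReal (Real.exp (-(r * t)) * ((r * t) ^ n / n.factorial)) := by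
  have hT := measurable_jumpTime hm n
  have hs : MeasurableSet {p : ℝ × ℝ | p.1 ≤ t ∧ t < p.1 + p.2} :=
    (measurableSet_le measurable_fst measurable_const).inter
      (measurableSet_lt measurable_const (measurable_fst.add measurable_snd))
  have := Measure.isProbabilityMeasure_map (μ := μ) hT.aemeasurable
  have := Measure.isProbabilityMeasure_map (μ := μ) (hm n).aemeasurable
  have hset : {ω | t ∈ Set.Ico (jumpTime H n ω) (jumpTime H (n + 1) ω)} =
      (fun ω => (jumpTime H n ω, H n ω)) ⁻¹' {p : ℝ × ℝ | p.1 ≤ t ∧ t < p.1 + p.2} := by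
    ext ω
    simp [jumpTime_succ]
  -- Given that the `n`-th jump occurs at `x ≤ t`, no further jump occurs up to `t` with probability
  -- `exp (-r * (t - x))`.
  have hsec : ∀ x, (expMeasure r) (Prod.mk x ⁻¹' {p : ℝ × ℝ | p.1 ≤ t ∧ t < p.1 + p.2}) =
      ENNReal.ofReal (Real.exp (-(r * t))) *
        (Set.Iic t).indicator (fun x => ENNReal.ofReal (Real.exp (r * x))) x := by
    intro x
    by_cases hx : x ≤ t
    · have : Prod.mk x ⁻¹' {p : ℝ × ℝ | p.1 ≤ t ∧ t < p.1 + p.2} = Set.Ioi (t - x) := by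
        ext s
        simp [hx, sub_lt_iff_lt_add']
      rw [this, expMeasure_Ioi hr (sub_nonneg.2 hx), Set.indicator_of_mem (by simpa using hx),
        ← ENNReal.ofReal_mul (Real.exp_nonneg _), ← Real.exp_add]
      ring_nf
    · simp [hx]
  rw [hset, ← Measure.map_apply (hT.prodMk (hm n)) hs,
    (indepFun_jumpTime hm hi n).map_prod_eq_prod_map_map hT.aemeasurable (hm n).aemeasurable,
    Measure.prod_apply hs, hl n]
  simp only [hsec]
  have hg : Measurable ((Set.Iic t).indicator (fun x : ℝ => ENNReal.ofReal (Real.exp (r * x)))) :=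
    Measurable.indicator (by fun_prop) measurableSet_Iic
  rw [lintegral_const_mul _ hg, lintegral_map hg hT, lintegral_exp_jumpTime hr hm hl hi,
    Set.indicator_of_mem (by simpa using ht), ENNReal.ofReal_mul (Real.exp_nonneg _)]

lemma tsum_ofReal_mul_poisson {b c : ℝ} (hb : 0 ≤ b) (hc : 0 ≤ c) :
    ∑' n : ℕ, ENNReal.ofReal (c ^ n) * ENNReal.ofReal (Real.exp (-b) * (b ^ n / n.factorial)) =
      ENNReal.ofReal (Real.exp ((c - 1) * b)) := by
  have hsum : HasSum (fun n : ℕ => Real.exp (-b) * ((c * b) ^ n / n.factorial))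
      (Real.exp ((c - 1) * b)) := by
    have := (NormedSpace.expSeries_div_hasSum_exp (c * b)).mul_left (Real.exp (-b))
    rwa [← Real.exp_eq_exp_ℝ, ← Real.exp_add, show -b + c * b = (c - 1) * b by ring] at this
  rw [← hsum.tsum_eq, ENNReal.ofReal_tsum_of_nonneg (fun n => by positivity) hsum.summable]
  congr 1 with n
  rw [← ENNReal.ofReal_mul (by positivity), mul_pow]
  ring_nf

/-- Non-explosion comes from the Poisson weights summing to `1` over almost surely disjoint events.
-/
lemma ae_exists_mem_Ico_jumpTime (hr : 0 < r) (hm : ∀ n, Measurable (H n))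
    (hl : ∀ n, μ.map (H n) = expMeasure r) (hi : iIndepFun H μ) {t : ℝ} (ht : 0 ≤ t) :
    ∀ᵐ ω ∂μ, ∃ n, t ∈ Set.Ico (jumpTime H n ω) (jumpTime H (n + 1) ω) := by
  set S : ℕ → Set Ω := fun n => {ω | t ∈ Set.Ico (jumpTime H n ω) (jumpTime H (n + 1) ω)}
  have hS : ∀ n, MeasurableSet (S n) := fun n => measurableSet_mem_Ico_jumpTime hm n t
  have hd : Pairwise (Function.onFun (AEDisjoint μ) S) := by
    intro m n hmn
    refine measure_eq_zero_iff_ae_notMem.2 ?_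
    filter_upwards [ae_strictMono_jumpTime hr hm hl] with ω hω h
    have h1 := jumpCount_eq_of_mem_Ico hω h.1
    rw [jumpCount_eq_of_mem_Ico hω h.2] at h1
    exact hmn (by exact_mod_cast h1.symm)
  have h1 : μ (⋃ n, S n) = 1 := by
    rw [measure_iUnion₀ hd fun n => (hS n).nullMeasurableSet]
    have := tsum_ofReal_mul_poisson (b := r * t) (c := 1) (by positivity) zero_le_one
    simp only [one_pow, ENNReal.ofReal_one, one_mul, sub_self, zero_mul, Real.exp_zero] at this
    rw [← this]
    congr 1 with n
    exact measure_mem_Ico_jumpTime hr hm hl hi n ht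
  filter_upwards [(mem_ae_iff_prob_eq_one (MeasurableSet.iUnion hS)).2 h1] with ω (hω : ω ∈ ⋃ n, S n)
  obtain ⟨n, hn⟩ := Set.mem_iUnion.1 hω
  exact ⟨n, hn⟩

lemma jumpCount_eq_ae_eq (hr : 0 < r) (hm : ∀ n, Measurable (H n))
    (hl : ∀ n, μ.map (H n) = expMeasure r) (hi : iIndepFun H μ) (n : ℕ) {t : ℝ} (ht : 0 ≤ t) :
    {ω | jumpCount H t ω = n} =ᵐ[μ]
      {ω | t ∈ Set.Ico (jumpTime H n ω) (jumpTime H (n + 1) ω)} := by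
  refine eventuallyEq_set.2 ?_
  filter_upwards [ae_strictMono_jumpTime hr hm hl, ae_exists_mem_Ico_jumpTime hr hm hl hi ht]
    with ω hω ⟨m, hmem⟩
  refine ⟨fun h => ?_, fun h => jumpCount_eq_of_mem_Ico hω h⟩
  have h' : jumpCount H t ω = n := h
  rw [jumpCount_eq_of_mem_Ico hω hmem] at h'
  have : m = n := by exact_mod_cast h'
  exact this ▸ hmem

/-- A function bounded by a geometric weight of the number of jumps has an integral bounded by
the generating function of the Poisson law. -/
lemma lintegral_le_of_le_pow_jumpCount (hr : 0 < r) (hm : ∀ n, Measurable (H n))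
    (hl : ∀ n, μ.map (H n) = expMeasure r) (hi : iIndepFun H μ) {t : ℝ} (ht : 0 ≤ t)
    {B c : ℝ} (hB : 0 ≤ B) (hc : 0 ≤ c) {g : Ω → ENNReal}
    (hg : ∀ᵐ ω ∂μ, ∀ n, t ∈ Set.Ico (jumpTime H n ω) (jumpTime H (n + 1) ω) →
      g ω ≤ ENNReal.ofReal (B * c ^ n)) :
    ∫⁻ ω, g ω ∂μ ≤ ENNReal.ofReal (B * Real.exp ((c - 1) * (r * t))) := by
  set S : ℕ → Set Ω := fun n => {ω | t ∈ Set.Ico (jumpTime H n ω) (jumpTime H (n + 1) ω)}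
  have hS : ∀ n, MeasurableSet (S n) := fun n => measurableSet_mem_Ico_jumpTime hm n t
  have huniv : (⋃ n, S n) =ᵐ[μ] Set.univ := by
    refine eventuallyEq_set.2 ?_
    filter_upwards [ae_exists_mem_Ico_jumpTime hr hm hl hi ht] with ω hω
    simpa [S] using hω
  calc ∫⁻ ω, g ω ∂μ = ∫⁻ ω in ⋃ n, S n, g ω ∂μ := by
        rw [setLIntegral_congr huniv, setLIntegral_univ]
    _ ≤ ∑' n, ∫⁻ ω in S n, g ω ∂μ := lintegral_iUnion_le _ _
    _ ≤ ∑' n, ENNReal.ofReal B * (ENNReal.ofReal (c ^ n) *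
          ENNReal.ofReal (Real.exp (-(r * t)) * ((r * t) ^ n / n.factorial))) := by
        refine ENNReal.tsum_le_tsum fun n => ?_
        rw [← measure_mem_Ico_jumpTime hr hm hl hi n ht, ← mul_assoc, ← ENNReal.ofReal_mul hB,
          ← setLIntegral_const]
        refine lintegral_mono_ae ?_
        rw [ae_restrict_iff' (hS n)]
        filter_upwards [hg] with ω hω hmem using hω n hmem
    _ = ENNReal.ofReal (B * Real.exp ((c - 1) * (r * t))) := by
        rw [ENNReal.tsum_mul_left, tsum_ofReal_mul_poisson (by positivity) hc,
          ENNReal.ofReal_mul hB]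

end JumpTimes

/-! ### Mean-square error of the stochastic Euler dynamics. -/

section EulerError

variable {Ω : Type*} [MeasurableSpace Ω] {μ : Measure Ω}

/-- Minkowski's inequality in `L²` for a random vector shifted by a constant. -/
lemma sqrt_integral_norm_add_const_sq_le [IsProbabilityMeasure μ] {E : Type*}
    [NormedAddCommGroup E] {X : Ω → E} (y : E) (hX : AEStronglyMeasurable X μ)
    (hX2 : Integrable (fun ω => ‖X ω‖ ^ 2) μ) :
    Integrable (fun ω => ‖X ω + y‖ ^ 2) μ ∧
      √(∫ ω, ‖X ω + y‖ ^ 2 ∂μ) ≤ √(∫ ω, ‖X ω‖ ^ 2 ∂μ) + ‖y‖ := by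
  have hL : MemLp X 2 μ := (memLp_two_iff_integrable_sq_norm hX).2 hX2
  have hy : MemLp (fun _ : Ω => y) 2 μ := memLp_const y
  have hadd : Integrable (fun ω => ‖X ω + y‖ ^ 2) μ :=
    (memLp_two_iff_integrable_sq_norm (hX.add aestronglyMeasurable_const)).1 (hL.add hy)
  refine ⟨hadd, ?_⟩
  have h1 : Integrable (fun ω => ‖X ω‖) μ := (hL.integrable one_le_two).norm
  set m := ∫ ω, ‖X ω‖ ∂μ with hm
  set b := ∫ ω, ‖X ω‖ ^ 2 ∂μ with hb
  have hb0 : 0 ≤ b := integral_nonneg fun ω => by positivity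
  have hquad : ∀ p q : ℝ, ∫ ω, (‖X ω‖ ^ 2 + p * ‖X ω‖ + q) ∂μ = b + p * m + q := fun p q => by
    have hi : Integrable (fun ω => ‖X ω‖ ^ 2 + p * ‖X ω‖) μ := hX2.add (h1.const_mul p)
    rw [integral_add hi (integrable_const q), integral_add hX2 (h1.const_mul p),
      integral_const_mul]
    simp [hm, hb]
  -- Nonnegativity of the variance of `‖X‖`.
  have hmb : m ≤ √b := by
    refine Real.le_sqrt_of_sq_le ?_
    have h0 : 0 ≤ ∫ ω, (‖X ω‖ - m) ^ 2 ∂μ := integral_nonneg fun ω => sq_nonneg _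
    have h2 : (fun ω => (‖X ω‖ - m) ^ 2) = fun ω => ‖X ω‖ ^ 2 + -2 * m * ‖X ω‖ + m ^ 2 := by
      ext ω; ring
    rw [h2, hquad] at h0
    nlinarith
  have hsq : √b ^ 2 = b := Real.sq_sqrt hb0
  refine Real.sqrt_le_iff.2 ⟨by positivity, ?_⟩
  calc ∫ ω, ‖X ω + y‖ ^ 2 ∂μ ≤ ∫ ω, (‖X ω‖ ^ 2 + 2 * ‖y‖ * ‖X ω‖ + ‖y‖ ^ 2) ∂μ := by
        refine integral_mono hadd
          ((hX2.add (h1.const_mul _)).add (integrable_const _)) fun ω => ?_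
        calc ‖X ω + y‖ ^ 2 ≤ (‖X ω‖ + ‖y‖) ^ 2 := by gcongr; exact norm_add_le _ _
          _ = _ := by ring
    _ = b + 2 * ‖y‖ * m + ‖y‖ ^ 2 := hquad _ _
    _ ≤ √b ^ 2 + 2 * ‖y‖ * √b + ‖y‖ ^ 2 := by rw [hsq]; gcongr
    _ = (√b + ‖y‖) ^ 2 := by ring

variable {d : ℕ} {L : EuclideanSpace ℝ (Fin d) →L[ℝ] EuclideanSpace ℝ (Fin d)}
  {u₀ : EuclideanSpace ℝ (Fin d)} {h : ℝ} {H : ℕ → Ω → ℝ}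
  {V Vbar : ℝ → Ω → EuclideanSpace ℝ (Fin d)}

lemma IsStochasticEulerDynamics.ae_norm_taylor_le (hh : 0 < h)
    (hV : IsStochasticEulerDynamics μ (fun x => L x) u₀ h H V Vbar) {c t : ℝ}
    (hc : 1 + ‖L‖ ≤ c) (hc' : 1 + t * ‖L‖ ≤ c) :
    ∀ᵐ ω ∂μ, ∀ n, t ∈ Set.Ico (jumpTime H n ω) (jumpTime H (n + 1) ω) →
      ‖V t ω - (u₀ + t • L u₀)‖ ≤ t ^ 2 * c ^ (n + 1) * ‖u₀‖ := by
  filter_upwards [hV.path, ae_strictMono_jumpTime (one_div_pos.2 hh) hV.measurable_step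
    hV.law_step] with ω hp hT n hn
  exact hp.norm_taylor_le (jumpTime_zero ω) hT hc hc' hn

variable [IsProbabilityMeasure μ]

/-- Squaring the pathwise bound leaves the geometric weight `(c ^ 2) ^ n`, to be averaged over the
Poisson law. Keeping `c` free allows times beyond `1`. -/
lemma IsStochasticEulerDynamics.integral_taylor_sq_le (hh : 0 < h)
    (hV : IsStochasticEulerDynamics μ (fun x => L x) u₀ h H V Vbar) {c t : ℝ} (ht : 0 ≤ t)
    (hc : 1 + ‖L‖ ≤ c) (hc' : 1 + t * ‖L‖ ≤ c) :
    Integrable (fun ω => ‖V t ω - (u₀ + t • L u₀)‖ ^ 2) μ ∧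
      ∫ ω, ‖V t ω - (u₀ + t • L u₀)‖ ^ 2 ∂μ ≤
        t ^ 4 * c ^ 2 * ‖u₀‖ ^ 2 * Real.exp ((c ^ 2 - 1) * (1 / h * t)) := by
  have hm : Measurable fun ω => ‖V t ω - (u₀ + t • L u₀)‖ ^ 2 :=
    ((hV.measurable_fst t ht).sub_const _).norm.pow_const 2
  have hle : ∫⁻ ω, ENNReal.ofReal (‖V t ω - (u₀ + t • L u₀)‖ ^ 2) ∂μ ≤
      ENNReal.ofReal (t ^ 4 * c ^ 2 * ‖u₀‖ ^ 2 * Real.exp ((c ^ 2 - 1) * (1 / h * t))) := by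
    refine lintegral_le_of_le_pow_jumpCount (one_div_pos.2 hh) hV.measurable_step hV.law_step
      hV.indep_step ht (by positivity) (by positivity) ?_
    filter_upwards [hV.ae_norm_taylor_le hh hc hc'] with ω hω n hn
    refine ENNReal.ofReal_le_ofReal ?_
    calc ‖V t ω - (u₀ + t • L u₀)‖ ^ 2 ≤ (t ^ 2 * c ^ (n + 1) * ‖u₀‖) ^ 2 := by
          gcongr; exact hω n hn
      _ = _ := by ring
  have hnonneg : 0 ≤ᵐ[μ] fun ω => ‖V t ω - (u₀ + t • L u₀)‖ ^ 2 :=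
    ae_of_all _ fun ω => sq_nonneg _
  refine ⟨⟨hm.aestronglyMeasurable, ?_⟩, ?_⟩
  · rw [hasFiniteIntegral_iff_ofReal hnonneg]
    exact hle.trans_lt ENNReal.ofReal_lt_top
  · rw [integral_eq_lintegral_of_nonneg_ae hnonneg hm.aestronglyMeasurable]
    exact ENNReal.toReal_le_of_le_ofReal (by positivity) hle

lemma IsStochasticEulerDynamics.sqrt_integral_sub_sq_le
    (hV : IsStochasticEulerDynamics μ (fun x => L x) u₀ h H V Vbar) {t : ℝ} (ht : 0 ≤ t)
    (y z : EuclideanSpace ℝ (Fin d)) (hi : Integrable (fun ω => ‖V t ω - y‖ ^ 2) μ) :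
    Integrable (fun ω => ‖V t ω - z‖ ^ 2) μ ∧
      √(∫ ω, ‖V t ω - z‖ ^ 2 ∂μ) ≤ √(∫ ω, ‖V t ω - y‖ ^ 2 ∂μ) + ‖z - y‖ := by
  have := sqrt_integral_norm_add_const_sq_le (y - z)
    ((hV.measurable_fst t ht).sub_const y).aestronglyMeasurable hi
  simpa [norm_sub_rev y z] using this

lemma IsStochasticEulerDynamics.sqrt_integral_cond_le (hh : 0 < h)
    (hV : IsStochasticEulerDynamics μ (fun x => L x) u₀ h H V Vbar)
    {u : ℝ → EuclideanSpace ℝ (Fin d)} (hu : IsODESolution (fun x => L x) u₀ u)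
    (k : ℕ) {t : ℝ} (ht : 0 < t) (ht1 : t ≤ 1)
    (hk : 0 < μ {ω | jumpCount H t ω = k}) :
    √(∫ ω, ‖V t ω - u t‖ ^ 2 ∂(μ[|{ω | jumpCount H t ω = k}])) ≤
      ((1 + ‖L‖) ^ (k + 1) + ‖L‖ ^ 2 / 2 * Real.exp ‖L‖) * ‖u₀‖ * t ^ 2 := by
  have hL := norm_nonneg L
  have : IsProbabilityMeasure (μ[|{ω | jumpCount H t ω = k}]) := cond_isProbabilityMeasure hk.ne'
  set C := ((1 + ‖L‖) ^ (k + 1) + ‖L‖ ^ 2 / 2 * Real.exp ‖L‖) * ‖u₀‖ * t ^ 2 with hC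
  have hC0 : 0 ≤ C := by positivity
  have hae : ∀ᵐ ω ∂(μ[|{ω | jumpCount H t ω = k}]), ‖V t ω - u t‖ ^ 2 ≤ C ^ 2 := by
    -- The conditional measure is a multiple of the restriction to the event, where the number of
    -- Euler steps is fixed.
    refine Measure.ae_smul_measure ?_ _
    rw [Measure.restrict_congr_set (jumpCount_eq_ae_eq (one_div_pos.2 hh) hV.measurable_step
      hV.law_step hV.indep_step k ht.le),
      ae_restrict_iff' (measurableSet_mem_Ico_jumpTime hV.measurable_step k t)]
    filter_upwards [hV.ae_norm_taylor_le (t := t) hh le_rfl (by nlinarith)] with ω hω hmem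
    gcongr
    calc ‖V t ω - u t‖ = ‖(V t ω - (u₀ + t • L u₀)) - (u t - (u₀ + t • L u₀))‖ := by
          congr 1; abel
      _ ≤ t ^ 2 * (1 + ‖L‖) ^ (k + 1) * ‖u₀‖ +
          t ^ 2 * (‖L‖ ^ 2 / 2 * Real.exp (t * ‖L‖)) * ‖u₀‖ :=
          (norm_sub_le _ _).trans (add_le_add (hω k hmem) (hu.norm_taylor_le ht.le))
      _ ≤ t ^ 2 * (1 + ‖L‖) ^ (k + 1) * ‖u₀‖ +
          t ^ 2 * (‖L‖ ^ 2 / 2 * Real.exp ‖L‖) * ‖u₀‖ := by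
          gcongr; nlinarith
      _ = C := by rw [hC]; ring
  refine Real.sqrt_le_iff.2 ⟨hC0, ?_⟩
  calc ∫ ω, ‖V t ω - u t‖ ^ 2 ∂(μ[|{ω | jumpCount H t ω = k}])
      ≤ ∫ _, C ^ 2 ∂(μ[|{ω | jumpCount H t ω = k}]) :=
        integral_mono_of_nonneg (ae_of_all _ fun ω => sq_nonneg _) (integrable_const _) hae
    _ = C ^ 2 := by simp

lemma IsStochasticEulerDynamics.sqrt_integral_error_le (hh : 0 < h)
    (hV : IsStochasticEulerDynamics μ (fun x => L x) u₀ h H V Vbar)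
    {u : ℝ → EuclideanSpace ℝ (Fin d)} (hu : IsODESolution (fun x => L x) u₀ u)
    {t : ℝ} (ht : 0 < t) (ht1 : t ≤ 1) :
    ∫ ω, ‖V t ω - (u₀ + t • L u₀)‖ ^ 2 ∂μ ≤ t ^ 4 * (1 + ‖L‖) ^ 2 *
        Real.exp ((2 * t * ‖L‖ + t * ‖L‖ ^ 2) / h) * ‖u₀‖ ^ 2 ∧
      √(∫ ω, ‖V t ω - u t‖ ^ 2 ∂μ) ≤
        t ^ 2 * ((1 + ‖L‖) * Real.exp ((2 * t * ‖L‖ + t * ‖L‖ ^ 2) / (2 * h)) +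
          ‖L‖ ^ 2 / 2 * Real.exp (t * ‖L‖)) * ‖u₀‖ := by
  have hL := norm_nonneg L
  obtain ⟨hi, hle⟩ := hV.integral_taylor_sq_le (c := 1 + ‖L‖) hh ht.le le_rfl (by nlinarith)
  have hexp : ((1 + ‖L‖) ^ 2 - 1) * (1 / h * t) = (2 * t * ‖L‖ + t * ‖L‖ ^ 2) / h := by
    field_simp; ring
  rw [hexp] at hle
  have hle' := hle.trans_eq (show _ = t ^ 4 * (1 + ‖L‖) ^ 2 *
    Real.exp ((2 * t * ‖L‖ + t * ‖L‖ ^ 2) / h) * ‖u₀‖ ^ 2 by ring)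
  refine ⟨hle', ?_⟩
  have h1 : √(∫ ω, ‖V t ω - (u₀ + t • L u₀)‖ ^ 2 ∂μ) ≤
      t ^ 2 * ((1 + ‖L‖) * Real.exp ((2 * t * ‖L‖ + t * ‖L‖ ^ 2) / (2 * h))) * ‖u₀‖ := by
    refine Real.sqrt_le_iff.2 ⟨by positivity, hle'.trans_eq ?_⟩
    have : Real.exp ((2 * t * ‖L‖ + t * ‖L‖ ^ 2) / h) =
        Real.exp ((2 * t * ‖L‖ + t * ‖L‖ ^ 2) / (2 * h)) ^ 2 := by
      rw [← Real.exp_nat_mul]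
      congr 1
      push_cast
      field_simp
    rw [this]
    ring
  calc √(∫ ω, ‖V t ω - u t‖ ^ 2 ∂μ) ≤ _ :=
        (hV.sqrt_integral_sub_sq_le ht.le _ (u t) hi).2.trans
          (add_le_add h1 (hu.norm_taylor_le ht.le))
    _ = _ := by ring

end EulerError

theorem mainTheorem2 {d : ℕ} {Ω : Type*} [MeasurableSpace Ω] (μ : Measure Ω)
    [IsProbabilityMeasure μ] (A : Matrix (Fin d) (Fin d) ℝ) (u₀ : EuclideanSpace ℝ (Fin d))
    (h : ℝ) (hh : 0 < h) (u : ℝ → EuclideanSpace ℝ (Fin d))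
    (hu : IsODESolution (fun x => Matrix.toEuclideanCLM (𝕜 := ℝ) A x) u₀ u)
    (H : ℕ → Ω → ℝ) (V Vbar : ℝ → Ω → EuclideanSpace ℝ (Fin d))
    (hV : IsStochasticEulerDynamics μ (fun x => Matrix.toEuclideanCLM (𝕜 := ℝ) A x) u₀ h H
      V Vbar) :
    -- the second moments and the conditional expectations below are well defined
    (∀ ε : ℝ, 0 < ε → Integrable (fun ω => ‖V ε ω - u ε‖ ^ 2) μ) ∧
    (∀ ε : ℝ, 0 < ε → ∀ k : ℕ, 0 < μ {ω | jumpCount H ε ω = k}) ∧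
    -- (i) the error conditionally on `K(ε) = k`
    (∀ k : ℕ, (fun ε : ℝ =>
        √(∫ ω, ‖V ε ω - u ε‖ ^ 2 ∂(μ[|{ω | jumpCount H ε ω = k}])))
      =O[𝓝[>] 0] fun ε : ℝ => ε ^ 2) ∧
    -- (ii) the unconditional error
    ((fun ε : ℝ => √(∫ ω, ‖V ε ω - u ε‖ ^ 2 ∂μ)) =O[𝓝[>] 0] fun ε : ℝ => ε ^ 2) ∧
    -- (iii) explicit bounds, first against the Taylor polynomial and then against `u(ε)`
    (∀ ε : ℝ, 0 < ε → ε ≤ 1 →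
      Integrable (fun ω => ‖V ε ω - (u₀ + ε • Matrix.toEuclideanCLM (𝕜 := ℝ) A u₀)‖ ^ 2) μ ∧
      ∫ ω, ‖V ε ω - (u₀ + ε • Matrix.toEuclideanCLM (𝕜 := ℝ) A u₀)‖ ^ 2 ∂μ ≤
        ε ^ 4 * (1 + ‖Matrix.toEuclideanCLM (𝕜 := ℝ) A‖) ^ 2 *
          Real.exp ((2 * ε * ‖Matrix.toEuclideanCLM (𝕜 := ℝ) A‖ +
            ε * ‖Matrix.toEuclideanCLM (𝕜 := ℝ) A‖ ^ 2) / h) * ‖u₀‖ ^ 2 ∧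
      √(∫ ω, ‖V ε ω - u ε‖ ^ 2 ∂μ) ≤
        ε ^ 2 * ((1 + ‖Matrix.toEuclideanCLM (𝕜 := ℝ) A‖) *
          Real.exp ((2 * ε * ‖Matrix.toEuclideanCLM (𝕜 := ℝ) A‖ +
            ε * ‖Matrix.toEuclideanCLM (𝕜 := ℝ) A‖ ^ 2) / (2 * h)) +
          ‖Matrix.toEuclideanCLM (𝕜 := ℝ) A‖ ^ 2 / 2 *
            Real.exp (ε * ‖Matrix.toEuclideanCLM (𝕜 := ℝ) A‖)) * ‖u₀‖) := by
  have hr : 0 < 1 / h := one_div_pos.2 hh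
  set L := Matrix.toEuclideanCLM (𝕜 := ℝ) A
  have hL : 0 ≤ ‖L‖ := norm_nonneg L
  have hpos : ∀ ε : ℝ, 0 < ε → ∀ k : ℕ, 0 < μ {ω | jumpCount H ε ω = k} := fun ε hε k => by
    rw [measure_congr (jumpCount_eq_ae_eq hr hV.measurable_step hV.law_step hV.indep_step k
      hε.le), measure_mem_Ico_jumpTime hr hV.measurable_step hV.law_step hV.indep_step k hε.le,
      ENNReal.ofReal_pos]
    positivity
  have hint : ∀ ε : ℝ, 0 < ε → Integrable (fun ω => ‖V ε ω - (u₀ + ε • L u₀)‖ ^ 2) μ :=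
    -- Here `ε` may exceed `1`, so `c` is enlarged by `ε * ‖L‖` to meet both step conditions.
    fun ε hε => (hV.integral_taylor_sq_le (c := 1 + ‖L‖ + ε * ‖L‖) hh hε.le
      (by nlinarith) (by nlinarith)).1
  have hIoc : Set.Ioc (0 : ℝ) 1 ∈ 𝓝[>] (0 : ℝ) := Ioc_mem_nhdsGT one_pos
  refine ⟨fun ε hε => (hV.sqrt_integral_sub_sq_le hε.le _ (u ε) (hint ε hε)).1, hpos,
    fun k => ?_, ?_, fun ε hε hε1 => ⟨hint ε hε, hV.sqrt_integral_error_le hh hu hε hε1⟩⟩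
  · refine IsBigO.of_bound
      (((1 + ‖L‖) ^ (k + 1) + ‖L‖ ^ 2 / 2 * Real.exp ‖L‖) * ‖u₀‖) ?_
    filter_upwards [hIoc] with ε hε
    rw [Real.norm_of_nonneg (Real.sqrt_nonneg _), Real.norm_of_nonneg (sq_nonneg _)]
    exact hV.sqrt_integral_cond_le hh hu k hε.1 hε.2 (hpos ε hε.1 k)
  -- The constant is the explicit bound with `ε` replaced by `1` in the exponentials, which increase
  -- in `ε`.
  · refine IsBigO.of_bound (((1 + ‖L‖) * Real.exp ((2 * ‖L‖ + ‖L‖ ^ 2) / (2 * h)) +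
      ‖L‖ ^ 2 / 2 * Real.exp ‖L‖) * ‖u₀‖) ?_
    filter_upwards [hIoc] with ε hε
    obtain ⟨hε0, hε1⟩ := hε
    rw [Real.norm_of_nonneg (Real.sqrt_nonneg _), Real.norm_of_nonneg (sq_nonneg _)]
    refine (hV.sqrt_integral_error_le hh hu hε0 hε1).2.trans ?_
    rw [mul_comm _ (ε ^ 2), ← mul_assoc]
    gcongr <;> nlinarith [sq_nonneg ‖L‖]
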